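/- **Setting.** A network is a finite directed graph $(\mathcal V,\mathcal L)$ with a gateway node $0$. Update packets $l=1,2,\dots$ are generated at times $0\le s_1\le s_2\le\cdots$ and arrive at the gateway at times $a_{l0}\ge s_l$, not necessarily in the order of generation, only finitely many of them in any bounded time; these sequences are otherwise arbitrary. Every packet that arrives at a node $i$ (from the source or over a link) is offered at once to all links $(i,j)$ leaving $i$. Each link sends one packet at a time and has a queue of buffer size $B_{ij}\in\{1,2,\dots\}\cup\{\infty\}$; a packet that comes to a full queue is either dropped or replaces a packet of the queue. Simultaneous events are processed one after the other, in an order that does not depend on the policy. The system is empty at time $0$. The durations of the successive transmissions over the link $(i,j)$ are i.i.d. with an arbitrary law $F_{ij}$ on $[0,\infty)$, independent across the links. A non-preemptive policy decides, from the observed history of the system (and possibly an independent random seed; transmission times are unknown until the transmission is completed), which waiting packet an idle link sends and which packet is dropped or replaced at a full queue; a transmission that has started is always completed. It is work-conserving if each link is busy whenever packets wait in its queue. Let $\Pi_{npwc}$ be the set of these causal non-preemptive work-conserving policies. The non-preemptive Last-Generated, First-Served policy (non-prmp-LGFS) sends, on each idle link, the freshest packet (largest generation time) of the queue; a packet that comes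 to a full queue replaces the oldest packet there if it was generated later than that one, and is dropped otherwise. Under a policy $\pi$, let $U_{j,\pi}(t)$ be the largest generation time of a packet that has arrived at node $j$ by time $t$ ($0$ if there is none), let $\Delta_{j,\pi}(t)=t-U_{j,\pi}(t)$ be the age at node $j$, and $\boldsymbol\Delta_\pi=\{(\Delta_{j,\pi}(t))_{j\in\mathcal V},\ t\ge 0\}$. For vector-valued processes, $X\le_{\rm st}Y$ means that for all $t_1<\dots<t_n$ and all upper sets $U$, $\mathbb P\{(X(t_1),\dots,X(t_n))\in U\}\le\mathbb P\{(Y(t_1),\dots,Y(t_n))\in U\}$. **Theorem 3.** Let the network, the buffer sizes $B_{ij}\ge1$, the generation and arrival sequences and the laws $F_{ij}$ be arbitrary. Then non-prmp-LGFS belongs to $\Pi_{npwc}$, and for every $\pi\in\Pi_{npwc}$ $$\boldsymbol\Delta_{\text{non-prmp-LGFS}}\le_{\rm st}\boldsymbol\Delta_\pi .$$ Moreover, for every real-valued functional $g$ of age processes that is non-decreasing ($g(\boldsymbol\Delta_1)\le g(\boldsymbol\Delta_2)$ whenever $\boldsymbol\Delta_1(t)\le\boldsymbol\Delta_2(t)$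 for all $t\ge0$), $$\mathbb E[g(\boldsymbol\Delta_{\text{non-prmp-LGFS}})]\le\mathbb E[g(\boldsymbol\Delta_\pi)]$$ whenever these expectations exist; that is, non-prmp-LGFS attains $\min_{\pi\in\Pi_{npwc}}\mathbb E[g(\boldsymbol\Delta_\pi)]$. -/

import Mathlib

open MeasureTheory
open scoped NNReal ENNReal

noncomputable section

namespace AgeNet

/-- The parameters of the system: a finite directed graph with a gateway node, the buffer sizes of
the link queues (possibly infinite), and the generation times `gen l` and the gateway arrival times
`arr l` of the update packets `l = 0, 1, 2, …`. Packets need not reach the gateway in the order of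
their generation. Simultaneous events are processed one at a time: `order` lists the packets in the
order in which they reach the gateway, and `rank` is the order in which events of the same instant
are processed (`none` stands for the gateway arrivals, `some e` for the deliveries over `e`). -/
structure Params (V : Type*) where
  links : Finset (V × V)
  gateway : V
  buffer : links → ℕ∞
  gen : ℕ → ℝ
  arr : ℕ → ℝ
  gen_nonneg : ∀ l, 0 ≤ gen l
  gen_mono : Monotone gen
  gen_le_arr : ∀ l, gen l ≤ arr l
  /-- Only finitely many packets arrive in a bounded time. -/
  arr_tendsto : Filter.Tendsto arr Filter.atTop Filter.atTop
  order : ℕ ≃ ℕ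
  order_mono : Monotone fun k => arr (order k)
  rank : Option links → ℕ
  rank_injective : Function.Injective rank

variable {V : Type*}

/-- A directed link, from `e.1.1` to `e.1.2`. -/
abbrev Params.Link (I : Params V) : Type _ := I.links

/-- Everything that can be observed in the system at some instant. Remaining transmission times are
not part of it. -/
structure State (I : Params V) where
  /-- current time -/
  clock : ℝ
  /-- packets waiting in the queue of each link (several copies of a packet may have come over
  different routes) -/
  queue : I.Link → Multiset ℕ
  /-- packet under transmission on each link, `none` if the link is idle -/
  serving : I.Link → Option ℕ
  /-- starting time of the current (or else the last) transmission on each link -/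
  startTime : I.Link → ℝ
  /-- number of completed transmissions on each link -/
  completed : I.Link → ℕ
  /-- number of packets that have arrived at the gateway from the external source -/
  admitted : ℕ
  /-- packets that have arrived at each node -/
  received : V → Set ℕ

/-- The empty system at time `0`. -/
def State.init (I : Params V) : State I where
  clock := 0
  queue _ := 0
  serving _ := none
  startTime _ := 0
  completed _ := 0
  admitted := 0
  received _ := ∅

/-- A causal non-preemptive policy: decisions are functions of the whole history of observed states.
The history is a list with the current state at its head.

* `serve h e` is the packet of the queue of the idle link `e` whose transmission is started now
  (`none`, or a packet that is not in the queue: the link stays idle);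
* `discard h e p` is called when `p` comes to the full queue of `e`: `some d` means that `p` replaces
  the packet `d` of the queue, and `none` that `p` is dropped. -/
structure Policy (I : Params V) where
  serve : List (State I) → I.Link → Option ℕ
  discard : List (State I) → I.Link → ℕ → Option ℕ

/-- A realization of the transmission times: `T (e, k)` is the duration of the `k`-th transmission
over the link `e`, counted from `0`. -/
abbrev TransmissionTimes (I : Params V) : Type _ := I.Link × ℕ → ℝ≥0

/-- The time of the next gateway arrival (`none`), or of the completion of the transmission that is
under way on a link. -/
def State.eventTime {I : Params V} (T : TransmissionTimes I) (x : State I) : Option I.Link → ℝ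
  | none => I.arr (I.order x.admitted)
  | some e => x.startTime e + T (e, x.completed e)

/-- The possible sources of the next event: the gateway and all busy links. -/
def State.active {I : Params V} (x : State I) : Set (Option I.Link) :=
  {c | ∀ e, c = some e → x.serving e ≠ none}

theorem State.exists_next {I : Params V} (T : TransmissionTimes I) (x : State I) :
    ∃ c ∈ x.active, ∀ c' ∈ x.active,
      toLex (x.eventTime T c, I.rank c) ≤ toLex (x.eventTime T c', I.rank c') :=
  Set.exists_min_image x.active (fun c => toLex (x.eventTime T c, I.rank c)) (Set.toFinite _)
    ⟨none, fun _ h => by simp at h⟩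

/-- The source of the next event: the earliest one, and the one of least rank among these. -/
def State.next {I : Params V} (T : TransmissionTimes I) (x : State I) : Option I.Link :=
  (x.exists_next T).choose

/-- The packet that arrives at a node at an event. -/
def State.eventPacket {I : Params V} (x : State I) : Option I.Link → ℕ
  | none => I.order x.admitted
  | some e => (x.serving e).getD 0

/-- The node at which it arrives. -/
def eventNode (I : Params V) : Option I.Link → V
  | none => I.gateway
  | some e => e.1.2

open scoped Classical in
/-- First part of an event: the clock is advanced, a packet arrives at a node, and the link that
delivered it (if any) becomes idle. -/
def State.deliver {I : Params V} (T : TransmissionTimes I) (x : State I) (c : Option I.Link) :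
    State I where
  clock := x.eventTime T c
  queue := x.queue
  serving e := if c = some e then none else x.serving e
  startTime := x.startTime
  completed e := if c = some e then x.completed e + 1 else x.completed e
  admitted := if c = none then x.admitted + 1 else x.admitted
  received v := if v = eventNode I c then insert (x.eventPacket c) (x.received v) else x.received v

open scoped Classical in
/-- Second part of an event: the packet `p` that has arrived at the node `v` is put into the queues
of all links leaving `v`. If a queue is full, then `p` is dropped or replaces a packet there. (A
packet that finds the link idle and the queue empty needs no buffer space.) `h` is the earlier
history. -/
def State.enqueue {I : Params V} (π : Policy I) (h : List (State I)) (x : State I) (v : V) (p : ℕ) :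
    State I :=
  { x with
    queue := fun e =>
      if e.1.1 = v then
        if ((x.queue e).card : ℕ∞) < I.buffer e ∨ (x.serving e = none ∧ x.queue e = 0) then
          p ::ₘ x.queue e
        else
          match π.discard (x :: h) e p with
          | some d => if d ∈ x.queue e then p ::ₘ (x.queue e).erase d else x.queue e
          | none => x.queue e
      else x.queue e }

open scoped Classical in
/-- The packet whose transmission the policy starts on the link `e`, if any. A busy link cannot start
a transmission. -/
def State.chosen {I : Params V} (π : Policy I) (h : List (State I)) (x : State I) (e : I.Link) :
    Option ℕ :=
  if x.serving e = none then (π.serve (x :: h) e).filter (fun p => decide (p ∈ x.queue e)) else none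

/-- Third part of an event: idle links may start to send a packet of their queue. -/
def State.dispatch {I : Params V} (π : Policy I) (h : List (State I)) (x : State I) : State I :=
  { x with
    queue := fun e =>
      match x.chosen π h e with
      | some p => (x.queue e).erase p
      | none => x.queue e
    serving := fun e =>
      match x.chosen π h e with
      | some p => some p
      | none => x.serving e
    startTime := fun e =>
      match x.chosen π h e with
      | some _ => x.clock
      | none => x.startTime e }

/-- One event of the system; `h` is the history before the state `x`. -/
def State.step {I : Params V} (π : Policy I) (T : TransmissionTimes I) (x : State I)
    (h : List (State I)) : State I :=
  let c := x.next T
  ((x.deliver T c).enqueue π (x :: h) (eventNode I c) (x.eventPacket c)).dispatch π (x :: h)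

/-- The state after `n` events, together with the earlier states, the latest one first. -/
def run {I : Params V} (π : Policy I) (T : TransmissionTimes I) : ℕ → State I × List (State I)
  | 0 => (State.init I, [])
  | n + 1 => ((run π T n).1.step π T (run π T n).2, (run π T n).1 :: (run π T n).2)

/-- The state after `n` events. -/
def stateAt {I : Params V} (π : Policy I) (T : TransmissionTimes I) (n : ℕ) : State I :=
  (run π T n).1

/-- A policy is work-conserving if each link is busy whenever packets wait in its queue. -/
def Policy.WorkConserving {I : Params V} (π : Policy I) : Prop :=
  ∀ (T : TransmissionTimes I) (n : ℕ) (e : I.Link),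
    (stateAt π T n).queue e ≠ 0 → (stateAt π T n).serving e ≠ none

/-- A packet of a finite collection with the largest generation time. -/
def freshest (I : Params V) (q : Multiset ℕ) : Option ℕ :=
  if h : q.toFinset.Nonempty then some (Finset.exists_max_image q.toFinset I.gen h).choose else none

/-- A packet of a finite collection with the smallest generation time. -/
def oldest (I : Params V) (q : Multiset ℕ) : Option ℕ :=
  if h : q.toFinset.Nonempty then some (Finset.exists_min_image q.toFinset I.gen h).choose else none

/-- The queue of the link `e` in the current state of a history. -/
def currentQueue {I : Params V} (h : List (State I)) (e : I.Link) : Multiset ℕ :=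
  match h with
  | [] => 0
  | x :: _ => x.queue e

/-- The non-preemptive Last-Generated, First-Served policy: an idle link sends the freshest packet of
its queue; a packet that comes to a full queue replaces the oldest packet there if it is fresher than
that one, and is dropped otherwise. -/
def lgfs (I : Params V) : Policy I where
  serve h e := freshest I (currentQueue h e)
  discard h e p := (oldest I (currentQueue h e)).filter (fun d => decide (I.gen d < I.gen p))

/-- `U_v(t)`: the generation time of the freshest packet that has arrived at the node `v` by time
`t` (and `0` if there is none). -/
def freshness {I : Params V} (π : Policy I) (T : TransmissionTimes I) (t : ℝ≥0) (v : V) : ℝ :=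
  sSup {u | u = 0 ∨ ∃ n, (stateAt π T n).clock ≤ t ∧ ∃ l ∈ (stateAt π T n).received v, u = I.gen l}

/-- The age of information at the node `v` at time `t`. -/
def age {I : Params V} (π : Policy I) (T : TransmissionTimes I) (t : ℝ≥0) (v : V) : ℝ :=
  t - freshness π T t v

/-- The law of the transmission times: independent across the links and i.i.d. over time, with law
`F e` on the link `e`. -/
def transmissionLaw {I : Params V} (F : I.Link → Measure ℝ≥0) [∀ e, IsProbabilityMeasure (F e)] :
    Measure (TransmissionTimes I) :=
  Measure.infinitePi fun p : I.Link × ℕ => F p.1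

/-- Multivariate stochastic order of random vectors, `X ≤_st Y`. -/
def VecStochLE {Ω Ω' ι : Type*} [MeasurableSpace Ω] [MeasurableSpace Ω'] (μ : Measure Ω)
    (X : Ω → ι → ℝ) (ν : Measure Ω') (Y : Ω' → ι → ℝ) : Prop :=
  ∀ U : Set (ι → ℝ), IsUpperSet U → μ {ω | X ω ∈ U} ≤ ν {ω | Y ω ∈ U}

/-- Stochastic order of vector-valued stochastic processes. -/
def ProcStochLE {Ω Ω' : Type*} [MeasurableSpace Ω] [MeasurableSpace Ω'] (μ : Measure Ω)
    (X : Ω → ℝ≥0 → V → ℝ) (ν : Measure Ω') (Y : Ω' → ℝ≥0 → V → ℝ) : Prop :=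
  ∀ (n : ℕ) (t : Fin n → ℝ≥0), StrictMono t →
    VecStochLE μ (fun ω (p : Fin n × V) => X ω (t p.1) p.2)
      ν (fun ω (p : Fin n × V) => Y ω (t p.1) p.2)

/-- The functions that can be age processes: `f t v = t - U v t` with `U v` non-decreasing and
`0 ≤ U v t ≤ t`. -/
def agePaths (V : Type*) : Set (ℝ≥0 → V → ℝ) :=
  {f | ∀ v, (∀ t, 0 ≤ f t v ∧ f t v ≤ t) ∧ Monotone fun t : ℝ≥0 => (t : ℝ) - f t v}

/-- An age penalty functional: it is non-decreasing, at least on age processes. -/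
def IsAgePenalty (g : (ℝ≥0 → V → ℝ) → ℝ) : Prop :=
  MonotoneOn g (agePaths V)

end AgeNet

end

namespace AgeNet

variable {V : Type*} {I : Params V}

/-! ### The event mechanism -/

/-! The proof is a sample-path comparison: both policies are run on the same `T`, so that the `k`-th
transmission over a link takes equally long under both.

Queue lengths, idle links and starting times evolve without regard to which packets are involved: a
full queue keeps its length whatever is discarded, and work conservation dictates which links start
to send. Hence the `n`-th event has the same time and the same source under all work-conserving
policies (`sameSkeleton_stateAt`).

It remains to compare packets event by event (`dominates_stateAt_lgfs`). The invariant says that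
every packet received or under transmission under the other policy is matched by one at least as
fresh under LGFS, where a packet in transit may also be matched by one already received at the head
of the link. Queues are not compared. When the other policy starts a packet, LGFS starts one on the
same link at the same event. The other packet came from the tail, where LGFS has something as fresh;
by `State.Forwarding`, LGFS has something as fresh in the queue, whose freshest packet it sends, or
already at the head.

The ages are thus ordered for every `T` and every seed (`age_lgfs_le`), and both conclusions follow
by monotonicity. -/

theorem State.next_mem_active (T : TransmissionTimes I) (x : State I) : x.next T ∈ x.active :=
  (x.exists_next T).choose_spec.1

theorem State.next_le (T : TransmissionTimes I) (x : State I) {c : Option I.Link}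
    (hc : c ∈ x.active) :
    toLex (x.eventTime T (x.next T), I.rank (x.next T)) ≤ toLex (x.eventTime T c, I.rank c) :=
  (x.exists_next T).choose_spec.2 c hc

theorem State.eventTime_next_le (T : TransmissionTimes I) (x : State I) {c : Option I.Link}
    (hc : c ∈ x.active) : x.eventTime T (x.next T) ≤ x.eventTime T c := by
  rcases Prod.Lex.toLex_le_toLex.1 (x.next_le T hc) with h | h
  · exact h.le
  · exact h.1.le

/-- The state just before the dispatch decisions of an event. -/
noncomputable def State.arrived (π : Policy I) (T : TransmissionTimes I) (x : State I) (h : List (State I)) :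
    State I :=
  (x.deliver T (x.next T)).enqueue π (x :: h) (eventNode I (x.next T)) (x.eventPacket (x.next T))

theorem State.step_eq (π : Policy I) (T : TransmissionTimes I) (x : State I) (h : List (State I)) :
    x.step π T h = (x.arrived π T h).dispatch π (x :: h) := rfl

theorem stateAt_succ (π : Policy I) (T : TransmissionTimes I) (n : ℕ) :
    stateAt π T (n + 1) = (stateAt π T n).step π T (run π T n).2 := rfl

theorem State.chosen_eq_some {π : Policy I} {h : List (State I)} {x : State I} {e : I.Link} {p : ℕ}
    (hp : x.chosen π h e = some p) : x.serving e = none ∧ p ∈ x.queue e := by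
  unfold State.chosen at hp
  split_ifs at hp with hs
  simp only [Option.filter_eq_some_iff, decide_eq_true_eq] at hp
  exact ⟨hs, hp.2⟩

theorem State.dispatch_of_chosen_eq_none {π : Policy I} {h : List (State I)} {x : State I}
    {e : I.Link} (hc : x.chosen π h e = none) :
    (x.dispatch π h).queue e = x.queue e ∧ (x.dispatch π h).serving e = x.serving e ∧
      (x.dispatch π h).startTime e = x.startTime e := by
  simp [State.dispatch, hc]

theorem State.dispatch_of_chosen_eq_some {π : Policy I} {h : List (State I)} {x : State I}
    {e : I.Link} {p : ℕ} (hc : x.chosen π h e = some p) :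
    (x.dispatch π h).queue e = (x.queue e).erase p ∧ (x.dispatch π h).serving e = some p ∧
      (x.dispatch π h).startTime e = x.clock := by
  simp only [State.dispatch, hc, and_self]

theorem State.mem_enqueue {π : Policy I} {h : List (State I)} {x : State I} {v : V} {p q : ℕ}
    {e : I.Link} (hq : q ∈ (x.enqueue π h v p).queue e) :
    q ∈ x.queue e ∨ (q = p ∧ e.1.1 = v) := by
  unfold State.enqueue at hq
  dsimp only at hq
  split_ifs at hq with h1 h2
  · rcases Multiset.mem_cons.1 hq with h | h
    · exact Or.inr ⟨h, h1⟩
    · exact Or.inl h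
  · split at hq
    · split_ifs at hq
      · rcases Multiset.mem_cons.1 hq with h | h
        · exact Or.inr ⟨h, h1⟩
        · exact Or.inl (Multiset.mem_of_mem_erase h)
      · exact Or.inl hq
    · exact Or.inl hq
  · exact Or.inl hq

/-- A replacement removes one packet and adds one, and a drop changes nothing. So the new length
depends on the old length and on idleness only, not on the policy. -/
theorem State.card_enqueue (π : Policy I) (h : List (State I)) (x : State I) (v : V) (p : ℕ)
    (e : I.Link) [Decidable (e.1.1 = v ∧
      (((x.queue e).card : ℕ∞) < I.buffer e ∨ (x.serving e = none ∧ (x.queue e).card = 0)))] :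
    ((x.enqueue π h v p).queue e).card =
      if e.1.1 = v ∧
        (((x.queue e).card : ℕ∞) < I.buffer e ∨ (x.serving e = none ∧ (x.queue e).card = 0))
      then (x.queue e).card + 1 else (x.queue e).card := by
  have h0 : x.queue e = 0 ↔ (x.queue e).card = 0 := Multiset.card_eq_zero.symm
  unfold State.enqueue
  dsimp only
  by_cases h1 : e.1.1 = v
  · by_cases h2 : ((x.queue e).card : ℕ∞) < I.buffer e ∨
        (x.serving e = none ∧ (x.queue e).card = 0)
    · rw [if_pos h1, if_pos (by rwa [h0]), if_pos ⟨h1, h2⟩, Multiset.card_cons]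
    · rw [if_pos h1, if_neg (by rwa [h0]), if_neg (fun H => h2 H.2)]
      split
      · split_ifs with h3
        · rw [Multiset.card_cons, Multiset.card_erase_add_one h3]
        · rfl
      · rfl
  · rw [if_neg h1, if_neg (fun H => h1 H.1)]

/-! ### Invariants of an arbitrary policy -/

/-- Queued and transmitted packets have been received at the tail of the link, received packets
have been generated, and no pending event lies in the past. -/
structure State.Consistent (T : TransmissionTimes I) (x : State I) : Prop where
  queue_mem : ∀ e, ∀ p ∈ x.queue e, p ∈ x.received e.1.1
  serving_mem : ∀ e p, x.serving e = some p → p ∈ x.received e.1.1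
  gen_le : ∀ v, ∀ p ∈ x.received v, I.gen p ≤ x.clock
  clock_le : ∀ c ∈ x.active, x.clock ≤ x.eventTime T c

theorem State.mem_deliver (T : TransmissionTimes I) {x : State I} {c : Option I.Link} {v : V}
    {p : ℕ} : p ∈ (x.deliver T c).received v ↔
      p ∈ x.received v ∨ (p = x.eventPacket c ∧ v = eventNode I c) := by
  unfold State.deliver
  dsimp only
  split_ifs with h
  · simp [h, or_comm]
  · simp [h]

theorem State.eventPacket_of_active {x : State I} {e : I.Link} (h : some e ∈ x.active) :
    x.serving e = some (x.eventPacket (some e)) := by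
  obtain ⟨p, hp⟩ := Option.ne_none_iff_exists'.1 (h e rfl)
  simp [State.eventPacket, hp]

theorem State.deliver_serving (T : TransmissionTimes I) {x : State I} {c : Option I.Link}
    {e : I.Link} {p : ℕ} (h : (x.deliver T c).serving e = some p) :
    c ≠ some e ∧ x.serving e = some p := by
  unfold State.deliver at h
  dsimp only at h
  split_ifs at h with hc
  exact ⟨hc, h⟩

theorem State.deliver_serving_of_ne (T : TransmissionTimes I) {x : State I} {c : Option I.Link}
    {e : I.Link} (hc : c ≠ some e) : (x.deliver T c).serving e = x.serving e := if_neg hc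

theorem State.Consistent.gen_eventPacket_le {T : TransmissionTimes I} {x : State I}
    (hx : x.Consistent T) {c : Option I.Link} (hc : c ∈ x.active) :
    I.gen (x.eventPacket c) ≤ x.eventTime T c := by
  cases c with
  | none => exact I.gen_le_arr _
  | some e =>
    exact (hx.gen_le _ _ (hx.serving_mem _ _ (State.eventPacket_of_active hc))).trans
      (hx.clock_le _ hc)

theorem State.Consistent.step {T : TransmissionTimes I} {x : State I} (hx : x.Consistent T)
    (π : Policy I) (h : List (State I)) : (x.step π T h).Consistent T := by
  have hq : ∀ e, ∀ p ∈ (x.arrived π T h).queue e, p ∈ (x.step π T h).received e.1.1 := by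
    intro e p hp
    refine (State.mem_deliver T).2 ?_
    rcases State.mem_enqueue hp with h1 | ⟨h1, h2⟩
    · exact Or.inl (hx.queue_mem e p h1)
    · exact Or.inr ⟨h1, h2⟩
  have hs : ∀ e p, (x.arrived π T h).serving e = some p →
      x.next T ≠ some e ∧ x.serving e = some p := fun e p hp => State.deliver_serving T hp
  refine ⟨fun e p hp => ?_, fun e p hp => ?_, fun v p hp => ?_, fun c hc => ?_⟩
  · rw [State.step_eq] at hp
    cases hc : (x.arrived π T h).chosen π (x :: h) e with
    | none => exact hq e p (by rwa [(State.dispatch_of_chosen_eq_none hc).1] at hp)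
    | some q =>
      rw [(State.dispatch_of_chosen_eq_some hc).1] at hp
      exact hq e p (Multiset.mem_of_mem_erase hp)
  · rw [State.step_eq] at hp
    cases hc : (x.arrived π T h).chosen π (x :: h) e with
    | none =>
      rw [(State.dispatch_of_chosen_eq_none hc).2.1] at hp
      exact (State.mem_deliver T).2 (Or.inl (hx.serving_mem e p (hs e p hp).2))
    | some q =>
      rw [(State.dispatch_of_chosen_eq_some hc).2.1] at hp
      cases hp
      exact hq e p (State.chosen_eq_some hc).2
  · change I.gen p ≤ x.eventTime T (x.next T)
    rcases (State.mem_deliver T).1 hp with h1 | ⟨rfl, -⟩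
    · exact (hx.gen_le v p h1).trans (hx.clock_le _ (x.next_mem_active T))
    · exact hx.gen_eventPacket_le (x.next_mem_active T)
  · change x.eventTime T (x.next T) ≤ _
    cases c with
    | none =>
      -- The pending arrival is either the old one or its successor in `order`, hence no earlier
      -- than the old one.
      change _ ≤ I.arr (I.order (if x.next T = none then x.admitted + 1 else x.admitted))
      refine (x.eventTime_next_le T (c := none) (fun _ h => by simp at h)).trans ?_
      apply I.order_mono
      split_ifs <;> omega
    | some e =>
      change _ ≤ (x.step π T h).startTime e + (T (e, (x.step π T h).completed e) : ℝ)
      rw [State.step_eq]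
      cases hch : (x.arrived π T h).chosen π (x :: h) e with
      | none =>
        -- A link that is busy without a new start did not deliver, so its event was already pending
        -- before the step.
        have h0 := hc e rfl
        rw [State.step_eq, (State.dispatch_of_chosen_eq_none hch).2.1] at h0
        obtain ⟨p, hp⟩ := Option.ne_none_iff_exists'.1 h0
        obtain ⟨h1, h2⟩ := hs e p hp
        rw [(State.dispatch_of_chosen_eq_none hch).2.2]
        have h3 : ((x.arrived π T h).dispatch π (x :: h)).completed e = x.completed e :=
          if_neg h1
        rw [h3]
        exact x.eventTime_next_le T (c := some e) (by
          rintro e' ⟨⟩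
          simp [h2])
      | some q =>
        rw [(State.dispatch_of_chosen_eq_some hch).2.2]
        exact le_add_of_nonneg_right (NNReal.coe_nonneg _)

theorem State.consistent_init (T : TransmissionTimes I) : (State.init I).Consistent T := by
  refine ⟨by simp [State.init], by simp [State.init], by simp [State.init], fun c hc => ?_⟩
  cases c with
  | none => exact (I.gen_nonneg _).trans (I.gen_le_arr _)
  | some e => exact absurd rfl (hc e rfl)

theorem consistent_stateAt (π : Policy I) (T : TransmissionTimes I) (n : ℕ) :
    (stateAt π T n).Consistent T := by
  induction n with
  | zero => exact State.consistent_init T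
  | succ n ih => exact ih.step π _

/-! ### Last-generated, first-served -/

theorem freshest_eq_some {q : Multiset ℕ} (hq : q ≠ 0) :
    ∃ p ∈ q, freshest I q = some p ∧ ∀ l ∈ q, I.gen l ≤ I.gen p := by
  have h : q.toFinset.Nonempty := Multiset.toFinset_nonempty.2 hq
  have hs := (Finset.exists_max_image q.toFinset I.gen h).choose_spec
  refine ⟨_, Multiset.mem_toFinset.1 hs.1, by rw [freshest, dif_pos h], fun l hl => ?_⟩
  exact hs.2 l (Multiset.mem_toFinset.2 hl)

theorem oldest_eq_some {q : Multiset ℕ} (hq : q ≠ 0) :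
    ∃ p ∈ q, oldest I q = some p ∧ ∀ l ∈ q, I.gen p ≤ I.gen l := by
  have h : q.toFinset.Nonempty := Multiset.toFinset_nonempty.2 hq
  have hs := (Finset.exists_min_image q.toFinset I.gen h).choose_spec
  refine ⟨_, Multiset.mem_toFinset.1 hs.1, by rw [oldest, dif_pos h], fun l hl => ?_⟩
  exact hs.2 l (Multiset.mem_toFinset.2 hl)

theorem State.chosen_lgfs {h : List (State I)} {x : State I} {e : I.Link}
    (hs : x.serving e = none) (hq : x.queue e ≠ 0) :
    ∃ p ∈ x.queue e, x.chosen (lgfs I) h e = some p ∧ ∀ l ∈ x.queue e, I.gen l ≤ I.gen p := by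
  obtain ⟨p, hp, hf, hmax⟩ := freshest_eq_some (I := I) hq
  refine ⟨p, hp, ?_, hmax⟩
  rw [State.chosen, if_pos hs]
  change Option.filter _ (freshest I (x.queue e)) = _
  rw [hf]
  simp [hp]

theorem workConserving_lgfs (I : Params V) : (lgfs I).WorkConserving := by
  intro T n e hq hs
  cases n with
  | zero => exact hq rfl
  | succ n =>
    rw [stateAt_succ, State.step_eq] at hq hs
    generalize (stateAt (lgfs I) T n).arrived (lgfs I) T _ = y at hq hs
    generalize stateAt (lgfs I) T n :: _ = h at hq hs
    cases hc : y.chosen (lgfs I) h e with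
    | none =>
      rw [(State.dispatch_of_chosen_eq_none hc).1] at hq
      rw [(State.dispatch_of_chosen_eq_none hc).2.1] at hs
      obtain ⟨p, -, hp, -⟩ := State.chosen_lgfs (h := h) hs hq
      simp [hp] at hc
    | some p =>
      rw [(State.dispatch_of_chosen_eq_some hc).2.1] at hs
      simp at hs

/-- The queue of LGFS after an arrival dominates the old queue and the new packet. -/
theorem State.exists_fresher_enqueue_lgfs (hB : ∀ e, 1 ≤ I.buffer e) (h : List (State I))
    (x : State I) (v : V) (p : ℕ) (e : I.Link) {l : ℕ}
    (hl : l ∈ x.queue e ∨ (l = p ∧ e.1.1 = v)) :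
    ∃ l' ∈ (x.enqueue (lgfs I) h v p).queue e, I.gen l ≤ I.gen l' := by
  unfold State.enqueue
  dsimp only
  by_cases h1 : e.1.1 = v
  swap
  · rw [if_neg h1]
    exact ⟨l, hl.resolve_right fun H => h1 H.2, le_rfl⟩
  rw [if_pos h1]
  split_ifs with h2
  · exact ⟨l, Multiset.mem_cons.2 (hl.symm.imp_left And.left), le_rfl⟩
  -- Since buffers have size at least one, a queue without room is nonempty and has an oldest
  -- packet.
  have hq : x.queue e ≠ 0 := by
    intro h0
    refine h2 (Or.inl ?_)
    rw [h0, Multiset.card_zero, Nat.cast_zero]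
    exact zero_lt_one.trans_le (hB e)
  obtain ⟨d, hd, ho, hmin⟩ := oldest_eq_some (I := I) hq
  have hdis : (lgfs I).discard (x :: h) e p = (some d).filter fun d => decide (I.gen d < I.gen p) :=
    ho ▸ rfl
  by_cases hlt : I.gen d < I.gen p
  · have : (lgfs I).discard (x :: h) e p = some d := by rw [hdis]; simp [hlt]
    simp only [this, if_pos hd]
    rcases hl with hl | ⟨rfl, -⟩
    -- The evicted packet is the only one at risk, and the fresher newcomer stands in for it.
    · by_cases hld : l = d
      · exact ⟨p, Multiset.mem_cons_self _ _, hld ▸ hlt.le⟩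
      · exact ⟨l, Multiset.mem_cons_of_mem ((Multiset.mem_erase_of_ne hld).2 hl), le_rfl⟩
    · exact ⟨l, Multiset.mem_cons_self _ _, le_rfl⟩
  · have : (lgfs I).discard (x :: h) e p = none := by rw [hdis]; simpa using not_lt.1 hlt
    simp only [this]
    rcases hl with hl | ⟨rfl, -⟩
    · exact ⟨l, hl, le_rfl⟩
    · exact ⟨d, hd, not_lt.1 hlt⟩

/-! ### All work-conserving policies share the event times -/

/-- Two states agree up to the identities of the packets. -/
structure State.SameSkeleton (x y : State I) : Prop where
  clock : x.clock = y.clock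
  card : ∀ e, (x.queue e).card = (y.queue e).card
  serving : ∀ e, x.serving e = none ↔ y.serving e = none
  startTime : x.startTime = y.startTime
  completed : x.completed = y.completed
  admitted : x.admitted = y.admitted

theorem State.SameSkeleton.eventTime {x y : State I} (h : x.SameSkeleton y)
    (T : TransmissionTimes I) (c : Option I.Link) : x.eventTime T c = y.eventTime T c := by
  cases c with
  | none => simp [State.eventTime, h.admitted]
  | some e => simp [State.eventTime, h.startTime, h.completed]

theorem State.SameSkeleton.active {x y : State I} (h : x.SameSkeleton y) :
    x.active = y.active := by
  ext c
  simp [State.active, h.serving]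

/-- Both choices minimize the same lexicographic key over the same set, and injectivity of `rank`
leaves no ties. -/
theorem State.SameSkeleton.next {x y : State I} (h : x.SameSkeleton y)
    (T : TransmissionTimes I) : x.next T = y.next T := by
  have h1 := x.next_le T (h.active ▸ y.next_mem_active T)
  have h2 := y.next_le T (h.active ▸ x.next_mem_active T)
  simp only [h.eventTime T] at h1
  have h3 := toLex.injective (le_antisymm h1 h2)
  exact I.rank_injective (Prod.ext_iff.1 h3).2

theorem State.SameSkeleton.arrived {x y : State I} (hxy : x.SameSkeleton y)
    (T : TransmissionTimes I) (π ρ : Policy I) (h k : List (State I)) :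
    (x.arrived π T h).SameSkeleton (y.arrived ρ T k) := by
  classical
  have hser : ∀ e, (x.deliver T (x.next T)).serving e = none ↔
      (y.deliver T (y.next T)).serving e = none := by
    intro e
    simp only [State.deliver, hxy.next T]
    split_ifs
    · rfl
    · exact hxy.serving e
  refine ⟨?_, fun e => ?_, hser, hxy.startTime, ?_, ?_⟩
  · exact (hxy.eventTime T _).trans (by rw [hxy.next T]; rfl)
  · have hcard : ((x.deliver T (x.next T)).queue e).card =
        ((y.deliver T (y.next T)).queue e).card := hxy.card e
    rw [State.arrived, State.arrived, State.card_enqueue, State.card_enqueue]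
    simp only [hcard, hser]
    rw [hxy.next T]
  · simp only [State.arrived, State.enqueue, State.deliver, hxy.next T, hxy.completed]
  · simp only [State.arrived, State.enqueue, State.deliver, hxy.next T, hxy.admitted]

/-- If no link is left idle with waiting packets, a transmission starts exactly on the idle links
with a nonempty queue. -/
theorem State.chosen_eq_none_iff {π : Policy I} {h : List (State I)} {x : State I} {e : I.Link}
    (hw : (x.dispatch π h).queue e ≠ 0 → (x.dispatch π h).serving e ≠ none) :
    x.chosen π h e = none ↔ (x.serving e = none → (x.queue e).card = 0) := by
  constructor
  · intro hc hs
    rw [(State.dispatch_of_chosen_eq_none hc).1, (State.dispatch_of_chosen_eq_none hc).2.1] at hw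
    by_contra h0
    exact hw (fun h1 => h0 (by rw [h1, Multiset.card_zero])) hs
  · intro hq
    by_contra hc
    obtain ⟨p, hp⟩ := Option.ne_none_iff_exists'.1 hc
    obtain ⟨h1, h2⟩ := State.chosen_eq_some hp
    have := Multiset.card_eq_zero.1 (hq h1)
    simp [this] at h2

/-- The hypotheses are work conservation after the dispatch. They leave the policies free to choose
the packet, but not to choose which links start. -/
theorem State.SameSkeleton.dispatch {x y : State I} (hxy : x.SameSkeleton y)
    {π ρ : Policy I} {h k : List (State I)}
    (hx : ∀ e, (x.dispatch π h).queue e ≠ 0 → (x.dispatch π h).serving e ≠ none)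
    (hy : ∀ e, (y.dispatch ρ k).queue e ≠ 0 → (y.dispatch ρ k).serving e ≠ none) :
    (x.dispatch π h).SameSkeleton (y.dispatch ρ k) := by
  have key : ∀ e, ((x.dispatch π h).queue e).card = ((y.dispatch ρ k).queue e).card ∧
      ((x.dispatch π h).serving e = none ↔ (y.dispatch ρ k).serving e = none) ∧
      (x.dispatch π h).startTime e = (y.dispatch ρ k).startTime e := by
    intro e
    have hiff : x.chosen π h e = none ↔ y.chosen ρ k e = none := by
      rw [State.chosen_eq_none_iff (hx e), State.chosen_eq_none_iff (hy e), hxy.serving, hxy.card]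
    cases hc : x.chosen π h e with
    | none =>
      obtain ⟨a1, a2, a3⟩ := State.dispatch_of_chosen_eq_none hc
      obtain ⟨b1, b2, b3⟩ := State.dispatch_of_chosen_eq_none (hiff.1 hc)
      rw [a1, a2, a3, b1, b2, b3]
      exact ⟨hxy.card e, hxy.serving e, congrFun hxy.startTime e⟩
    | some p =>
      obtain ⟨q, hd⟩ := Option.ne_none_iff_exists'.1 fun H => by simp [hiff.2 H] at hc
      obtain ⟨a1, a2, a3⟩ := State.dispatch_of_chosen_eq_some hc
      obtain ⟨b1, b2, b3⟩ := State.dispatch_of_chosen_eq_some hd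
      rw [a1, a2, a3, b1, b2, b3, Multiset.card_erase_of_mem (State.chosen_eq_some hc).2,
        Multiset.card_erase_of_mem (State.chosen_eq_some hd).2, hxy.card]
      exact ⟨rfl, by simp, hxy.clock⟩
  exact ⟨hxy.clock, fun e => (key e).1, fun e => (key e).2.1, funext fun e => (key e).2.2,
    hxy.completed, hxy.admitted⟩

theorem sameSkeleton_stateAt {π ρ : Policy I} (hπ : π.WorkConserving) (hρ : ρ.WorkConserving)
    (T : TransmissionTimes I) (n : ℕ) : (stateAt π T n).SameSkeleton (stateAt ρ T n) := by
  induction n with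
  | zero => exact ⟨rfl, fun _ => rfl, fun _ => Iff.rfl, rfl, rfl, rfl⟩
  | succ n ih => exact (ih.arrived T π ρ _ _).dispatch (hπ T (n + 1)) (hρ T (n + 1))

/-! ### Domination -/

/-- In the state `x` the freshest packet received at the tail of each link is waiting, under
transmission, or superseded at the head of the link. -/
def State.Forwarding (x : State I) : Prop :=
  ∀ e : I.Link, ∀ l ∈ x.received e.1.1, ∃ l', I.gen l ≤ I.gen l' ∧
    (l' ∈ x.queue e ∨ x.serving e = some l' ∨ l' ∈ x.received e.1.2)

/-- The nodes in the state `x` have fresher packets than in the state `y`, now and after the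
transmissions that are under way. -/
structure State.Dominates (x y : State I) : Prop where
  received : ∀ v, ∀ l ∈ y.received v, ∃ l' ∈ x.received v, I.gen l ≤ I.gen l'
  serving : ∀ e l, y.serving e = some l → ∃ l', I.gen l ≤ I.gen l' ∧
    (x.serving e = some l' ∨ l' ∈ x.received e.1.2)

/-- A representative in the queue survives up to replacement by a fresher one, and one whose
transmission ends moves to the head of the link. -/
theorem State.Forwarding.arrived (hB : ∀ e, 1 ≤ I.buffer e) {x : State I} (hx : x.Forwarding)
    (T : TransmissionTimes I) (h : List (State I)) : (x.arrived (lgfs I) T h).Forwarding := by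
  intro e l hl
  have enq : ∀ l, (l ∈ x.queue e ∨ (l = x.eventPacket (x.next T) ∧
      e.1.1 = eventNode I (x.next T))) →
      ∃ l' ∈ (x.arrived (lgfs I) T h).queue e, I.gen l ≤ I.gen l' :=
    fun l hl => State.exists_fresher_enqueue_lgfs hB (x :: h) (x.deliver T (x.next T)) _ _ e hl
  rcases (State.mem_deliver T).1 hl with hl | hl
  · obtain ⟨l', hle, hq | hs | hr⟩ := hx e l hl
    · obtain ⟨l'', hq', hle'⟩ := enq l' (Or.inl hq)
      exact ⟨l'', hle.trans hle', Or.inl hq'⟩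
    · refine ⟨l', hle, Or.inr ?_⟩
      by_cases hc : x.next T = some e
      · right
        refine (State.mem_deliver T).2 (Or.inr ?_)
        rw [hc]
        exact ⟨by simp [State.eventPacket, hs], rfl⟩
      · left
        exact (State.deliver_serving_of_ne T hc).trans hs
    · exact ⟨l', hle, Or.inr (Or.inr ((State.mem_deliver T).2 (Or.inl hr)))⟩
  · obtain ⟨l'', hq', hle'⟩ := enq l (Or.inr hl)
    exact ⟨l'', hle', Or.inl hq'⟩

/-- After the dispatch decisions of LGFS, an idle link whose transmission starts is fully
represented by the transmitted packet. -/
theorem State.Forwarding.dispatch_of_idle {x : State I} (hx : x.Forwarding) (h : List (State I))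
    {e : I.Link} (hs : x.serving e = none) {l : ℕ} (hl : l ∈ x.received e.1.1) :
    ∃ l', I.gen l ≤ I.gen l' ∧
      ((x.dispatch (lgfs I) h).serving e = some l' ∨ l' ∈ x.received e.1.2) := by
  obtain ⟨l', hle, hq | hs' | hr⟩ := hx e l hl
  · obtain ⟨p, -, hc, hmax⟩ := State.chosen_lgfs (h := h) hs
      (fun h0 => by simp [h0] at hq : x.queue e ≠ 0)
    exact ⟨p, hle.trans (hmax _ hq), Or.inl (State.dispatch_of_chosen_eq_some hc).2.1⟩
  · simp [hs] at hs'
  · exact ⟨l', hle, Or.inr hr⟩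

theorem State.chosen_of_busy {π : Policy I} {h : List (State I)} {x : State I} {e : I.Link}
    (hs : x.serving e ≠ none) : x.chosen π h e = none := if_neg hs

theorem State.Forwarding.dispatch {x : State I} (hx : x.Forwarding) (h : List (State I)) :
    (x.dispatch (lgfs I) h).Forwarding := by
  intro e l hl
  by_cases hs : x.serving e = none
  · obtain ⟨l', hle, H⟩ := hx.dispatch_of_idle h hs hl
    exact ⟨l', hle, Or.inr H⟩
  · obtain ⟨h1, h2, -⟩ := State.dispatch_of_chosen_eq_none (State.chosen_of_busy (π := lgfs I)
      (h := h) hs)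
    rw [h1, h2]
    exact hx e l hl

theorem forwarding_stateAt_lgfs (hB : ∀ e, 1 ≤ I.buffer e) (T : TransmissionTimes I) (n : ℕ) :
    (stateAt (lgfs I) T n).Forwarding := by
  induction n with
  | zero => exact fun e l hl => hl.elim
  | succ n ih => exact (ih.arrived hB T _).dispatch _

/-- Deliveries are simultaneous and domination does not mention queues, so the discarding rules of
the two policies play no role here. -/
theorem State.Dominates.arrived {x y : State I} (hd : x.Dominates y) (hxy : x.SameSkeleton y)
    (T : TransmissionTimes I) (π ρ : Policy I) (h k : List (State I)) :
    (x.arrived π T h).Dominates (y.arrived ρ T k) := by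
  have mono : ∀ v l, l ∈ x.received v → l ∈ (x.arrived π T h).received v :=
    fun v l hl => (State.mem_deliver T).2 (Or.inl hl)
  refine ⟨fun v l hl => ?_, fun e l hl => ?_⟩
  · rcases (State.mem_deliver T).1 hl with hl | ⟨rfl, rfl⟩
    · obtain ⟨l', hl', hle⟩ := hd.received v l hl
      exact ⟨l', mono v l' hl', hle⟩
    · have hnew : x.eventPacket (x.next T) ∈
          (x.arrived π T h).received (eventNode I (x.next T)) :=
        (State.mem_deliver T).2 (Or.inr ⟨rfl, rfl⟩)
      have hact := y.next_mem_active T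
      rw [← hxy.next T] at hact ⊢
      cases hc : x.next T with
      | none =>
        rw [hc] at hnew
        exact ⟨_, hnew, by simp [State.eventPacket, hxy.admitted]⟩
      | some e =>
        rw [hc] at hnew hact
        obtain ⟨l', hle, hs | hr⟩ := hd.serving e _ (State.eventPacket_of_active hact)
        · have : x.eventPacket (some e) = l' := by simp [State.eventPacket, hs]
          exact ⟨l', this ▸ hnew, hle⟩
        -- The packet that `x` delivers now may be stale; the witness had reached the head earlier.
        · exact ⟨l', mono _ l' hr, hle⟩
  · obtain ⟨hc, hs⟩ := State.deliver_serving T hl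
    obtain ⟨l', hle, hs' | hr⟩ := hd.serving e l hs
    · exact ⟨l', hle, Or.inl ((State.deliver_serving_of_ne T (hxy.next T ▸ hc)).trans hs')⟩
    · exact ⟨l', hle, Or.inr (mono _ l' hr)⟩

theorem State.Dominates.dispatch {x y : State I} (hd : x.Dominates y) (hxy : x.SameSkeleton y)
    (hx : x.Forwarding) (hy : ∀ e, ∀ p ∈ y.queue e, p ∈ y.received e.1.1) (ρ : Policy I)
    (h k : List (State I)) : (x.dispatch (lgfs I) h).Dominates (y.dispatch ρ k) := by
  refine ⟨hd.received, fun e l hl => ?_⟩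
  cases hc : y.chosen ρ k e with
  | none =>
    rw [(State.dispatch_of_chosen_eq_none hc).2.1] at hl
    -- The link was busy before the dispatch in `y`, hence also in `x`, and both keep their
    -- transmissions.
    have hs : x.serving e ≠ none := fun H => by simp [(hxy.serving e).1 H] at hl
    rw [(State.dispatch_of_chosen_eq_none (State.chosen_of_busy hs)).2.1]
    exact hd.serving e l hl
  | some q =>
    rw [(State.dispatch_of_chosen_eq_some hc).2.1] at hl
    cases hl
    obtain ⟨hs, hq⟩ := State.chosen_eq_some hc
    obtain ⟨l', hl', hle⟩ := hd.received _ _ (hy e l hq)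
    obtain ⟨l'', hle', H⟩ := hx.dispatch_of_idle h ((hxy.serving e).2 hs) hl'
    exact ⟨l'', hle.trans hle', H⟩

theorem dominates_stateAt_lgfs (hB : ∀ e, 1 ≤ I.buffer e) {ρ : Policy I} (hρ : ρ.WorkConserving)
    (T : TransmissionTimes I) (n : ℕ) : (stateAt (lgfs I) T n).Dominates (stateAt ρ T n) := by
  induction n with
  | zero => exact ⟨fun v l hl => hl.elim, fun e l hl => by simp [stateAt, run, State.init] at hl⟩
  | succ n ih =>
    have hsk := sameSkeleton_stateAt (workConserving_lgfs I) hρ T n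
    refine (ih.arrived hsk T (lgfs I) ρ _ _).dispatch (hsk.arrived T _ _ _ _)
      ((forwarding_stateAt_lgfs hB T n).arrived hB T _) (fun e p hp => ?_) ρ _ _
    refine (State.mem_deliver T).2 ?_
    rcases State.mem_enqueue hp with h1 | h1
    · exact Or.inl ((consistent_stateAt ρ T n).queue_mem e p h1)
    · exact Or.inr h1

/-! ### Ages -/

theorem le_of_mem_freshness {π : Policy I} {T : TransmissionTimes I} {t : ℝ≥0} {v : V} {u : ℝ}
    (hu : u = 0 ∨ ∃ n, (stateAt π T n).clock ≤ t ∧ ∃ l ∈ (stateAt π T n).received v, u = I.gen l) :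
    u ≤ t := by
  rcases hu with rfl | ⟨n, hn, l, hl, rfl⟩
  · exact t.2
  · exact ((consistent_stateAt π T n).gen_le v l hl).trans hn

theorem le_freshness {π : Policy I} {T : TransmissionTimes I} {t : ℝ≥0} {v : V} {u : ℝ}
    (hu : u = 0 ∨ ∃ n, (stateAt π T n).clock ≤ t ∧ ∃ l ∈ (stateAt π T n).received v, u = I.gen l) :
    u ≤ freshness π T t v :=
  le_csSup ⟨(t : ℝ), fun _ hu => le_of_mem_freshness hu⟩ hu

/-- Needed because penalties are monotone only on `agePaths`. The bounds rest on the fact that no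
packet is received before it is generated. -/
theorem age_mem_agePaths (π : Policy I) (T : TransmissionTimes I) : age π T ∈ agePaths V := by
  intro v
  refine ⟨fun t => ⟨sub_nonneg.2 (?_ : freshness π T t v ≤ t),
    sub_le_self (t : ℝ) (le_freshness (Or.inl rfl))⟩, fun s t hst => ?_⟩
  · exact csSup_le ⟨0, Or.inl rfl⟩ fun _ hu => le_of_mem_freshness hu
  · simp only [age, sub_sub_cancel]
    refine csSup_le ⟨0, Or.inl rfl⟩ fun u hu => le_freshness (hu.imp_right ?_)
    rintro ⟨n, hn, h⟩
    exact ⟨n, hn.trans (NNReal.coe_le_coe.2 hst), h⟩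

/-- The clocks agree at each event, so a packet counted for `ρ` by time `t` at event `n` is beaten
by one counted for LGFS at the same `n`. -/
theorem age_lgfs_le (hB : ∀ e, 1 ≤ I.buffer e) {ρ : Policy I} (hρ : ρ.WorkConserving)
    (T : TransmissionTimes I) : age (lgfs I) T ≤ age ρ T := by
  refine fun t v => sub_le_sub_left (?_ : freshness ρ T t v ≤ freshness (lgfs I) T t v) (t : ℝ)
  refine csSup_le ⟨0, Or.inl rfl⟩ ?_
  rintro u (rfl | ⟨n, hn, l, hl, rfl⟩)
  · exact le_freshness (Or.inl rfl)
  · obtain ⟨l', hl', hle⟩ := (dominates_stateAt_lgfs hB hρ T n).received v l hl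
    refine hle.trans (le_freshness (Or.inr ⟨n, ?_, l', hl', rfl⟩))
    rwa [(sameSkeleton_stateAt (workConserving_lgfs I) hρ T n).clock]

instance (F : I.Link → Measure ℝ≥0) [∀ e, IsProbabilityMeasure (F e)] :
    IsProbabilityMeasure (transmissionLaw F) :=
  inferInstanceAs (IsProbabilityMeasure (Measure.infinitePi fun p : I.Link × ℕ => F p.1))

end AgeNet

/-! ### From sample paths to laws and expectations -/

theorem theorem3 {V : Type*} [Finite V] (I : AgeNet.Params V)
    (hB : ∀ e, 1 ≤ I.buffer e)
    (F : I.Link → MeasureTheory.Measure ℝ≥0) [∀ e, MeasureTheory.IsProbabilityMeasure (F e)] :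
    (AgeNet.lgfs I).WorkConserving ∧
    ∀ {Ξ : Type*} [MeasurableSpace Ξ] (κ : MeasureTheory.Measure Ξ)
      [MeasureTheory.IsProbabilityMeasure κ] (π : Ξ → AgeNet.Policy I),
      (∀ ξ, (π ξ).WorkConserving) →
      AgeNet.ProcStochLE
        (AgeNet.transmissionLaw F) (fun T => AgeNet.age (AgeNet.lgfs I) T)
        ((AgeNet.transmissionLaw F).prod κ) (fun ω => AgeNet.age (π ω.2) ω.1) ∧
      ∀ g : (ℝ≥0 → V → ℝ) → ℝ, AgeNet.IsAgePenalty g →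
        MeasureTheory.Integrable (fun T => g (AgeNet.age (AgeNet.lgfs I) T))
          (AgeNet.transmissionLaw F) →
        MeasureTheory.Integrable (fun ω : AgeNet.TransmissionTimes I × Ξ =>
            g (AgeNet.age (π ω.2) ω.1))
          ((AgeNet.transmissionLaw F).prod κ) →
        ∫ T, g (AgeNet.age (AgeNet.lgfs I) T) ∂(AgeNet.transmissionLaw F) ≤
          ∫ ω, g (AgeNet.age (π ω.2) ω.1) ∂((AgeNet.transmissionLaw F).prod κ) := by
  refine ⟨AgeNet.workConserving_lgfs I, fun {Ξ} _ κ _ π hπ => ⟨fun n t _ U hU => ?_,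
    fun g hg hi hi' => ?_⟩⟩
  -- LGFS is lifted to the product space with the seed, which it ignores. Neither the rectangle
  -- formula nor monotonicity of the measure needs measurable sets, so `U` may be any upper set.
  · calc _ = ((AgeNet.transmissionLaw F).prod κ)
          ({T | (fun p : Fin n × V => AgeNet.age (AgeNet.lgfs I) T (t p.1) p.2) ∈ U} ×ˢ
            Set.univ) := by
          rw [MeasureTheory.Measure.prod_prod, MeasureTheory.measure_univ, mul_one]
      _ ≤ _ := MeasureTheory.measure_mono fun ω hω =>
          hU (fun p => AgeNet.age_lgfs_le hB (hπ ω.2) ω.1 (t p.1) p.2) hω.1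
  · calc _ = ∫ ω : AgeNet.TransmissionTimes I × Ξ, g (AgeNet.age (AgeNet.lgfs I) ω.1)
          ∂((AgeNet.transmissionLaw F).prod κ) := by
          rw [MeasureTheory.integral_fun_fst
            (fun T : AgeNet.TransmissionTimes I => g (AgeNet.age (AgeNet.lgfs I) T))]
          simp
      _ ≤ _ := MeasureTheory.integral_mono (hi.comp_fst κ) hi' fun ω =>
          hg (AgeNet.age_mem_agePaths _ _) (AgeNet.age_mem_agePaths _ _)
            (AgeNet.age_lgfs_le hB (hπ ω.2) ω.1)
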